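/- Let $K$ be a field, $S=K[x_1,\ldots,x_n]$ the polynomial ring in $n$ variables, and $\mathfrak m=(x_1,\ldots,x_n)$. For an ideal $I\subseteq S$ let $\mathcal R(I)=\bigoplus_{k\ge 0}I^kt^k\subseteq S[t]$ be its Rees ring, and let its analytic spread $\ell(I)$ be the Krull dimension of the fiber ring $\mathcal R(I)/\mathfrak m\mathcal R(I)$. Let $I$ and $J$ be monomial ideals of $S$ generated in disjoint sets of variables, i.e. there are disjoint $U,V\subseteq\{1,\ldots,n\}$ such that $I$ is generated by monomials in the variables $x_i$, $i\in U$, and $J$ is generated by monomials in the variables $x_j$, $j\in V$. (a) If $I$ and $J$ are proper ideals, then $\ell(I+J)=\ell(I)+\ell(J)$. (b) If $I$ and $J$ are nonzero, then $\ell(IJ)=\ell(I)+\ell(J)-1$. -/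

import Mathlib

namespace AnalyticSpread

variable {K : Type*} [Field K] {n : ℕ}

/-- `I` is a monomial ideal of `K[x₁, …, xₙ]` generated by monomials in the variables `xᵢ`, `i ∈ V`.
(Empty generating sets and the monomial `1` are allowed, so the zero and the unit ideal qualify for
every `V`.) -/
def IsMonomialIn (V : Set (Fin n)) (I : Ideal (MvPolynomial (Fin n) K)) : Prop :=
  ∃ A : Set (Fin n →₀ ℕ), (∀ a ∈ A, ∀ i ∈ a.support, i ∈ V) ∧
    I = Ideal.span ((fun a => MvPolynomial.monomial a (1 : K)) '' A)

/-- The fiber ring `R(I) / 𝔪 R(I)` of the Rees ring `R(I) = ⊕ₖ Iᵏ tᵏ ⊆ S[t]` of an ideal `I` of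
`S = K[x₁, …, xₙ]`, where `𝔪 = (x₁, …, xₙ)`. -/
abbrev FiberRing (I : Ideal (MvPolynomial (Fin n) K)) : Type _ :=
  reesAlgebra I ⧸ (MvPolynomial.idealOfVars (Fin n) K).map
    (algebraMap (MvPolynomial (Fin n) K) (reesAlgebra I))

/-- The analytic spread `ℓ(I)`: the Krull dimension of the fiber ring. -/
noncomputable def analyticSpread (I : Ideal (MvPolynomial (Fin n) K)) : WithBot ℕ∞ :=
  ringKrullDim (FiberRing I)

/-- The analytic spread is a natural number (neither `⊥` nor `∞`). -/
theorem exists_nat_eq_analyticSpread (I : Ideal (MvPolynomial (Fin n) K)) :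
    ∃ d : ℕ, analyticSpread I = d := by
  have hne : (MvPolynomial.idealOfVars (Fin n) K).map
      (algebraMap (MvPolynomial (Fin n) K) (reesAlgebra I)) ≠ ⊤ := by
    intro h
    let f : reesAlgebra I →+* K := (MvPolynomial.constantCoeff.comp
      Polynomial.constantCoeff).comp (reesAlgebra I).val.toRingHom
    have hle : (MvPolynomial.idealOfVars (Fin n) K).map
        (algebraMap (MvPolynomial (Fin n) K) (reesAlgebra I)) ≤ RingHom.ker f := by
      rw [Ideal.map_le_iff_le_comap, MvPolynomial.idealOfVars, Ideal.span_le]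
      rintro _ ⟨i, rfl⟩
      simp [f, RingHom.mem_ker]
    exact RingHom.ker_ne_top f (top_le_iff.mp (h ▸ hle))
  have : Nontrivial (FiberRing I) := Ideal.Quotient.nontrivial_iff.mpr hne
  have : Algebra.FiniteType K (reesAlgebra I) :=
    Algebra.FiniteType.trans (S := MvPolynomial (Fin n) K) inferInstance inferInstance
  have : Algebra.FiniteType K (FiberRing I) :=
    Algebra.FiniteType.of_surjective (Ideal.Quotient.mkₐ K _) (Ideal.Quotient.mkₐ_surjective K _)
  obtain ⟨m, f, hf⟩ := (Algebra.FiniteType.iff_quotient_mvPolynomial'' (R := K)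
    (S := FiberRing I)).mp this
  have hle : analyticSpread I ≤ (m : WithBot ℕ∞) := by
    refine (ringKrullDim_le_of_surjective f.toRingHom hf).trans ?_
    simp
  have h0 : (0 : WithBot ℕ∞) ≤ analyticSpread I := ringKrullDim_nonneg_of_nontrivial
  revert hle h0
  generalize analyticSpread I = d
  intro hle h0
  induction d with
  | bot => simp at h0
  | coe d =>
    have hd : d ≤ (m : ℕ∞) := by exact_mod_cast hle
    lift d to ℕ using ne_top_of_le_ne_top (ENat.coe_ne_top m) hd
    exact ⟨d, rfl⟩

end AnalyticSpread

/-! The fiber ring of a monomial ideal has a `K`-basis given by the minimal monomial generators of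
all powers `I ^ k`, and a product of two basis elements is a basis element or zero. This makes the
analytic spread combinatorial: it is the largest number of generators with exponents `v i` all of
whose products remain minimal generators (`IsFace`) and for which the vectors `(v i, 1)` are
linearly independent (`IsIndep`). Such a family is algebraically independent in the fiber ring, so
it bounds the dimension from below. Conversely, Noether normalization yields a prime modulo which a
family of monomial generators of full size is algebraically independent; its products are then
nonzero and distinct, which is the face condition together with independence
(`exists_analyticSpread_eq_and_isFaceRank`).

Since the variables are disjoint, exponents are compared separately on the two sides. For `I + J`, a
face splits into its `I`-part and its `J`-part, and faces can be joined, so ranks add. For `I * J`,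
a face consists of sums `a i + b i` in which the `a i` and the `b i` are again faces. Both summands
carry the same power of `t`, so the pairs lie in a hyperplane of the product of the two spans: this
is the `-1`. Pairing two independent faces along a double star attains the bound. -/

namespace AnalyticSpread

/-! ### Krull dimension and algebraic independence -/

/-- Krull dimension is invariant under injective integral extensions. -/
theorem ringKrullDim_eq_of_isIntegral_of_injective {R S : Type*} [CommRing R] [CommRing S]
    [Algebra R S] [Algebra.IsIntegral R S] (hinj : Function.Injective (algebraMap R S)) :
    ringKrullDim S = ringKrullDim R := by
  apply le_antisymm
  · refine Order.krullDim_le_of_strictMono (PrimeSpectrum.comap (algebraMap R S)) ?_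
    intro p q hpq
    exact Ideal.IsIntegral.comap_lt_comap hpq
  · refine iSup_le fun l => ?_
    have hker : RingHom.ker (algebraMap R S) ≤ l.head.asIdeal := by
      rw [(RingHom.injective_iff_ker_eq_bot _).mp hinj]
      exact bot_le
    obtain ⟨Q, -, hQ, hQl⟩ := Ideal.exists_ideal_over_prime_of_isIntegral l.head.asIdeal
      (⊥ : Ideal S) hker
    have : Q.LiesOver l.head.asIdeal := ⟨hQl.symm⟩
    obtain ⟨L, hL, -⟩ := Ideal.exists_ltSeries_of_hasGoingUp l Q
    rw [← hL]
    exact le_iSup (fun L : LTSeries (PrimeSpectrum S) => ((L.length : ℕ∞) : WithBot ℕ∞)) L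

/-- An algebraically independent family stays independent modulo some prime ideal. -/
theorem exists_isPrime_algebraicIndependent_mk {K A ι : Type*} [Field K] [CommRing A] [Algebra K A]
    {x : ι → A} (hx : AlgebraicIndependent K x) :
    ∃ P : Ideal A, P.IsPrime ∧ AlgebraicIndependent K (fun i => Ideal.Quotient.mk P (x i)) := by
  have hinj : Function.Injective (MvPolynomial.aeval (R := K) x) := hx
  -- The zero ideal of the polynomial ring is prime and is the contraction of zero, so some prime of
  -- `A` contracts to it.
  obtain ⟨P, hP, -, hPx⟩ := Ideal.exists_comap_eq_of_mem_minimalPrimes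
    (MvPolynomial.aeval (R := K) x).toRingHom (I := (⊥ : Ideal A)) ⊥ (by
      have : Ideal.comap (MvPolynomial.aeval (R := K) x).toRingHom ⊥ = ⊥ :=
        (RingHom.injective_iff_ker_eq_bot _).mp hinj
      rw [this]
      exact ⟨⟨Ideal.isPrime_bot, le_rfl⟩, fun _ _ _ => bot_le⟩)
  refine ⟨P, hP, ?_⟩
  rw [algebraicIndependent_iff_injective_aeval]
  have hcomp : MvPolynomial.aeval (R := K) (fun i => Ideal.Quotient.mk P (x i)) =
      (Ideal.Quotient.mkₐ K P).comp (MvPolynomial.aeval x) := by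
    ext i
    simp
  rw [hcomp, injective_iff_map_eq_zero]
  intro p hp
  have : p ∈ Ideal.comap (MvPolynomial.aeval (R := K) x).toRingHom P := by
    rw [Ideal.mem_comap]
    exact Ideal.Quotient.eq_zero_iff_mem.mp hp
  rw [hPx] at this
  simpa using this

/-- The Krull dimension of a finitely generated algebra bounds the size of algebraically
independent families, and is attained modulo a prime by a family of generators. -/
theorem exists_nat_ringKrullDim_eq {K A : Type*} [Field K] [CommRing A] [Nontrivial A] [Algebra K A]
    [Algebra.FiniteType K A] (X : Set A) (hX : Algebra.adjoin K X = ⊤) :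
    ∃ d : ℕ, ringKrullDim A = d ∧
      (∀ (r : ℕ) (x : Fin r → A), AlgebraicIndependent K x → r ≤ d) ∧
      ∃ P : Ideal A, P.IsPrime ∧ ∃ x : Fin d → A, (∀ i, x i ∈ X) ∧
        AlgebraicIndependent K (fun i => Ideal.Quotient.mk P (x i)) := by
  obtain ⟨d, g, hg, hint⟩ := exists_integral_inj_algHom_of_fg K A
  refine ⟨d, ?_, ?_, ?_⟩
  · algebraize [g.toRingHom]
    have : Algebra.IsIntegral (MvPolynomial (Fin d) K) A := ⟨hint⟩
    rw [ringKrullDim_eq_of_isIntegral_of_injective (R := MvPolynomial (Fin d) K) hg,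
      MvPolynomial.ringKrullDim_of_isNoetherianRing]
    simp
  · intro r x hx
    -- Passing to a domain makes transcendence degree available; `A ⧸ P` is still integral over the
    -- image of the Noether normalization, which has `d` generators.
    obtain ⟨P, hP, hxP⟩ := exists_isPrime_algebraicIndependent_mk hx
    let h : MvPolynomial (Fin d) K →ₐ[K] A ⧸ P := (Ideal.Quotient.mkₐ K P).comp g
    have hh : h.IsIntegral :=
      hint.trans _ _ (RingHom.isIntegral_of_surjective _ Ideal.Quotient.mk_surjective)
    let y : Fin d → A ⧸ P := fun i => h (MvPolynomial.X i)
    have hy : MvPolynomial.aeval y = h := by ext i; simp [y]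
    have halg : Algebra.IsAlgebraic (Algebra.adjoin K (Set.range y)) (A ⧸ P) := by
      refine ⟨fun a => IsIntegral.isAlgebraic ?_⟩
      obtain ⟨p, hp, hpa⟩ := hh a
      let h' : MvPolynomial (Fin d) K →+* Algebra.adjoin K (Set.range y) :=
        h.toRingHom.codRestrict (Algebra.adjoin K (Set.range y)) fun q => by
          rw [Algebra.adjoin_range_eq_range_aeval, hy]
          exact ⟨q, rfl⟩
      refine ⟨p.map h', hp.map h', ?_⟩
      rw [Polynomial.eval₂_map]
      exact hpa
    have h1 := hxP.lift_cardinalMk_le_trdeg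
    have h2 := Algebra.IsAlgebraic.trdeg_le_cardinalMk K (Set.range y)
    have h3 : Cardinal.mk (Set.range y) ≤ d := by
      simpa using Cardinal.mk_range_le_lift (f := y)
    have h4 := h2.trans h3
    have h5 := h1.trans (Cardinal.lift_le.mpr h4)
    simpa using h5
  · have hgX : AlgebraicIndependent K (fun i => g (MvPolynomial.X i)) := by
      rw [algebraicIndependent_iff_injective_aeval]
      have : MvPolynomial.aeval (fun i => g (MvPolynomial.X i)) = g := by ext i; simp
      rwa [this]
    obtain ⟨P, hP, hPg⟩ := exists_isPrime_algebraicIndependent_mk hgX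
    refine ⟨P, hP, ?_⟩
    have hX' : Algebra.adjoin K (Ideal.Quotient.mkₐ K P '' X) = ⊤ := by
      rw [← AlgHom.map_adjoin, hX, Algebra.map_top, AlgHom.range_eq_top]
      exact Ideal.Quotient.mkₐ_surjective K P
    have halg : Algebra.IsAlgebraic (Algebra.adjoin K (Ideal.Quotient.mkₐ K P '' X)) (A ⧸ P) := by
      refine ⟨fun a => ?_⟩
      have ha : a ∈ Algebra.adjoin K (Ideal.Quotient.mkₐ K P '' X) := by rw [hX']; trivial
      exact isAlgebraic_algebraMap
        (⟨a, ha⟩ : Algebra.adjoin K (Ideal.Quotient.mkₐ K P '' X))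
    -- `A ⧸ P` has transcendence degree at least `d` and is generated by the image of `X`, so a
    -- transcendence basis can be extracted from that image.
    obtain ⟨t, ht, htb⟩ := exists_isTranscendenceBasis_subset (R := K)
      (Ideal.Quotient.mkₐ K P '' X)
    have h1 := hPg.lift_cardinalMk_le_trdeg
    have h2 := htb.cardinalMk_eq_trdeg
    have h3 : (Cardinal.lift.{_, 0} (Cardinal.mk (Fin d))) ≤ Cardinal.lift.{0} (Cardinal.mk t) := by
      rw [h2]; exact h1
    obtain ⟨e⟩ := Cardinal.lift_mk_le'.mp h3
    choose x hxX hx using fun i => ht (e i).2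
    refine ⟨x, hxX, ?_⟩
    have := htb.1.comp e e.injective
    convert this using 1
    ext i
    exact hx i

end AnalyticSpread

namespace AnalyticSpread

/-! ### Exponents of products of generators, faces and independence -/

variable {σ ι κ : Type*}

/-- The set of sums of `k` elements of `A`. -/
def nfoldSum (A : Set (σ →₀ ℕ)) : ℕ → Set (σ →₀ ℕ)
  | 0 => {0}
  | k + 1 => Set.image2 (· + ·) A (nfoldSum A k)

section nfoldSum

variable {A B : Set (σ →₀ ℕ)}

theorem add_mem_nfoldSum {i j : ℕ} {s t : σ →₀ ℕ} (hs : s ∈ nfoldSum A i)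
    (ht : t ∈ nfoldSum A j) : s + t ∈ nfoldSum A (i + j) := by
  induction i generalizing s with
  | zero =>
    obtain rfl : s = 0 := hs
    simpa using ht
  | succ i ih =>
    obtain ⟨a, ha, s', hs', rfl⟩ := hs
    rw [Nat.add_right_comm]
    exact ⟨a, ha, s' + t, ih hs', (add_assoc _ _ _).symm⟩

theorem mem_nfoldSum_one {a : σ →₀ ℕ} (ha : a ∈ A) : a ∈ nfoldSum A 1 :=
  ⟨a, ha, 0, rfl, add_zero a⟩

theorem nsmul_mem_nfoldSum {a : σ →₀ ℕ} (ha : a ∈ A) (k : ℕ) : k • a ∈ nfoldSum A k := by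
  induction k with
  | zero => exact zero_nsmul a
  | succ k ih =>
    rw [succ_nsmul]
    exact add_mem_nfoldSum ih (mem_nfoldSum_one ha)

theorem sum_mem_nfoldSum {v : ι → σ →₀ ℕ} (hv : ∀ i, v i ∈ A) (c : ι → ℕ) (s : Finset ι) :
    ∑ i ∈ s, c i • v i ∈ nfoldSum A (∑ i ∈ s, c i) := by
  classical
  induction s using Finset.induction_on with
  | empty => simp [nfoldSum]
  | insert i s hi ih =>
    rw [Finset.sum_insert hi, Finset.sum_insert hi]
    exact add_mem_nfoldSum (nsmul_mem_nfoldSum (hv i) _) ih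

theorem nfoldSum_mono (h : A ⊆ B) (k : ℕ) : nfoldSum A k ⊆ nfoldSum B k := by
  induction k with
  | zero => exact subset_rfl
  | succ k ih => exact Set.image2_subset h ih

theorem exists_of_mem_nfoldSum_union {k : ℕ} {s : σ →₀ ℕ} (hs : s ∈ nfoldSum (A ∪ B) k) :
    ∃ i j, i + j = k ∧ ∃ t ∈ nfoldSum A i, ∃ u ∈ nfoldSum B j, t + u = s := by
  induction k generalizing s with
  | zero => exact ⟨0, 0, rfl, 0, rfl, 0, rfl, by simpa [nfoldSum] using hs.symm⟩
  | succ k ih =>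
    obtain ⟨a, ha, s', hs', rfl⟩ := hs
    obtain ⟨i, j, rfl, t, ht, u, hu, rfl⟩ := ih hs'
    rcases ha with ha | ha
    · exact ⟨i + 1, j, by omega, a + t, ⟨a, ha, t, ht, rfl⟩, u, hu, add_assoc _ _ _⟩
    · exact ⟨i, j + 1, by omega, t, ht, a + u, ⟨a, ha, u, hu, rfl⟩, add_left_comm _ _ _⟩

theorem mem_nfoldSum_image2 {k : ℕ} {s : σ →₀ ℕ} :
    s ∈ nfoldSum (Set.image2 (· + ·) A B) k ↔
      ∃ t ∈ nfoldSum A k, ∃ u ∈ nfoldSum B k, t + u = s := by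
  induction k generalizing s with
  | zero => simp [nfoldSum, eq_comm]
  | succ k ih =>
    constructor
    · rintro ⟨_, ⟨a, ha, b, hb, rfl⟩, s', hs', rfl⟩
      obtain ⟨t, ht, u, hu, rfl⟩ := ih.mp hs'
      exact ⟨a + t, ⟨a, ha, t, ht, rfl⟩, b + u, ⟨b, hb, u, hu, rfl⟩, add_add_add_comm _ _ _ _⟩
    · rintro ⟨_, ⟨a, ha, t, ht, rfl⟩, _, ⟨b, hb, u, hu, rfl⟩, rfl⟩
      exact ⟨a + b, ⟨a, ha, b, hb, rfl⟩, t + u, ih.mpr ⟨t, ht, u, hu, rfl⟩,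
        add_add_add_comm _ _ _ _⟩

/-- Discarding summands, all nonzero, strictly decreases the sum. -/
theorem exists_lt_mem_nfoldSum (h0 : (0 : σ →₀ ℕ) ∉ A) {i k : ℕ} (hik : i < k) {s : σ →₀ ℕ}
    (hs : s ∈ nfoldSum A k) : ∃ t ∈ nfoldSum A i, t < s := by
  induction k generalizing s with
  | zero => omega
  | succ k ih =>
    obtain ⟨a, ha, s', hs', rfl⟩ := hs
    have hlt : s' < a + s' := by
      have : 0 < a := pos_iff_ne_zero.mpr fun h => h0 (h ▸ ha)
      exact lt_add_of_pos_left s' this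
    rcases Nat.lt_succ_iff_lt_or_eq.mp hik with h | rfl
    · obtain ⟨t, ht, hts⟩ := ih h hs'
      exact ⟨t, ht, hts.trans hlt⟩
    · exact ⟨s', hs', hlt⟩

theorem eq_zero_of_mem_nfoldSum {U : Set σ} (hA : ∀ a ∈ A, ∀ i ∈ a.support, i ∈ U) {k : ℕ}
    {s : σ →₀ ℕ} (hs : s ∈ nfoldSum A k) {i : σ} (hi : i ∉ U) : s i = 0 := by
  induction k generalizing s with
  | zero =>
    obtain rfl : s = 0 := hs
    rfl
  | succ k ih =>
    obtain ⟨a, ha, s', hs', rfl⟩ := hs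
    have : a i = 0 := by
      by_contra h
      exact hi (hA a ha i (Finsupp.mem_support_iff.mpr h))
    simp [this, ih hs']

theorem degree_le_of_mem_nfoldSum {m : ℕ} (hA : ∀ a ∈ A, m ≤ a.degree) {k : ℕ} {s : σ →₀ ℕ}
    (hs : s ∈ nfoldSum A k) : k * m ≤ s.degree := by
  induction k generalizing s with
  | zero => simp
  | succ k ih =>
    obtain ⟨a, ha, s', hs', rfl⟩ := hs
    have h1 := hA a ha
    have h2 := ih hs'
    simp only [map_add]
    linarith

end nfoldSum

section disjoint

variable {A B : Set (σ →₀ ℕ)} {U V : Set σ}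

/-- Exponent vectors supported in disjoint sets of variables are compared separately. -/
theorem le_and_le_of_add_le_add (hUV : Disjoint U V) (hA : ∀ a ∈ A, ∀ i ∈ a.support, i ∈ U)
    (hB : ∀ a ∈ B, ∀ i ∈ a.support, i ∈ V) {i j k l : ℕ} {s t u w : σ →₀ ℕ}
    (hs : s ∈ nfoldSum A i) (ht : t ∈ nfoldSum B j) (hu : u ∈ nfoldSum A k)
    (hw : w ∈ nfoldSum B l) (h : s + t ≤ u + w) : s ≤ u ∧ t ≤ w := by
  constructor <;> intro x <;> have hx := h x <;> simp only [Finsupp.add_apply] at hx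
  · by_cases hxU : x ∈ U
    · have := eq_zero_of_mem_nfoldSum hB hw (Set.disjoint_left.mp hUV hxU)
      omega
    · have := eq_zero_of_mem_nfoldSum hA hs hxU
      omega
  · by_cases hxV : x ∈ V
    · have := eq_zero_of_mem_nfoldSum hA hu (Set.disjoint_right.mp hUV hxV)
      omega
    · have := eq_zero_of_mem_nfoldSum hB ht hxV
      omega

theorem eq_and_eq_of_add_eq_add (hUV : Disjoint U V) (hA : ∀ a ∈ A, ∀ i ∈ a.support, i ∈ U)
    (hB : ∀ a ∈ B, ∀ i ∈ a.support, i ∈ V) {i j k l : ℕ} {s t u w : σ →₀ ℕ}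
    (hs : s ∈ nfoldSum A i) (ht : t ∈ nfoldSum B j) (hu : u ∈ nfoldSum A k)
    (hw : w ∈ nfoldSum B l) (h : s + t = u + w) : s = u ∧ t = w := by
  have h1 := le_and_le_of_add_le_add hUV hA hB hs ht hu hw h.le
  have h2 := le_and_le_of_add_le_add hUV hA hB hu hw hs ht h.ge
  exact ⟨le_antisymm h1.1 h2.1, le_antisymm h1.2 h2.2⟩

/-- A competitor `u + w` satisfies `u ≤ s` and `w ≤ t`. If its numbers of factors differ from `(i,
j)`, one side has too many; dropping the excess gives a strictly smaller element of the right
length, against minimality of `s` or `t`. -/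
theorem minimal_add_nfoldSum_union (hUV : Disjoint U V) (hA : ∀ a ∈ A, ∀ i ∈ a.support, i ∈ U)
    (hB : ∀ a ∈ B, ∀ i ∈ a.support, i ∈ V) (hA0 : (0 : σ →₀ ℕ) ∉ A) (hB0 : (0 : σ →₀ ℕ) ∉ B)
    {i j : ℕ} {s t : σ →₀ ℕ} (hs : Minimal (· ∈ nfoldSum A i) s)
    (ht : Minimal (· ∈ nfoldSum B j) t) :
    Minimal (· ∈ nfoldSum (A ∪ B) (i + j)) (s + t) := by
  refine ⟨add_mem_nfoldSum (nfoldSum_mono Set.subset_union_left _ hs.1)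
    (nfoldSum_mono Set.subset_union_right _ ht.1), ?_⟩
  intro r hr hrle
  obtain ⟨k, l, hkl, u, hu, w, hw, rfl⟩ := exists_of_mem_nfoldSum_union hr
  obtain ⟨hus, hwt⟩ := le_and_le_of_add_le_add hUV hA hB hu hw hs.1 ht.1 hrle
  rcases lt_trichotomy i k with h | rfl | h
  · obtain ⟨u', hu', hlt⟩ := exists_lt_mem_nfoldSum hA0 h hu
    exact absurd (hs.2 hu' (hlt.le.trans hus)) (hlt.trans_le hus).not_ge
  · obtain rfl : l = j := by omega
    exact add_le_add (hs.2 hu hus) (ht.2 hw hwt)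
  · have h' : j < l := by omega
    obtain ⟨w', hw', hlt⟩ := exists_lt_mem_nfoldSum hB0 h' hw
    exact absurd (ht.2 hw' (hlt.le.trans hwt)) (hlt.trans_le hwt).not_ge

theorem minimal_add_nfoldSum_image2 (hUV : Disjoint U V) (hA : ∀ a ∈ A, ∀ i ∈ a.support, i ∈ U)
    (hB : ∀ a ∈ B, ∀ i ∈ a.support, i ∈ V) {k : ℕ} {s t : σ →₀ ℕ}
    (hs : Minimal (· ∈ nfoldSum A k) s) (ht : Minimal (· ∈ nfoldSum B k) t) :
    Minimal (· ∈ nfoldSum (Set.image2 (· + ·) A B) k) (s + t) := by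
  refine ⟨mem_nfoldSum_image2.mpr ⟨s, hs.1, t, ht.1, rfl⟩, ?_⟩
  intro r hr hrle
  obtain ⟨u, hu, w, hw, rfl⟩ := mem_nfoldSum_image2.mp hr
  obtain ⟨hus, hwt⟩ := le_and_le_of_add_le_add hUV hA hB hu hw hs.1 ht.1 hrle
  exact add_le_add (hs.2 hu hus) (ht.2 hw hwt)

end disjoint

theorem degree_unique_of_minimal_nfoldSum {A : Set (σ →₀ ℕ)} (h0 : (0 : σ →₀ ℕ) ∉ A) {i j : ℕ}
    {s : σ →₀ ℕ} (hi : Minimal (· ∈ nfoldSum A i) s) (hj : Minimal (· ∈ nfoldSum A j) s) :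
    i = j := by
  rcases lt_trichotomy i j with h | h | h
  · obtain ⟨t, ht, hlt⟩ := exists_lt_mem_nfoldSum h0 h hj.1
    exact absurd (hi.2 ht hlt.le) hlt.not_ge
  · exact h
  · obtain ⟨t, ht, hlt⟩ := exists_lt_mem_nfoldSum h0 h hi.1
    exact absurd (hj.2 ht hlt.le) hlt.not_ge

/-- All products of the monomials with exponents `v i` are minimal generators of the corresponding
powers of the monomial ideal with generating exponents `A`. -/
def IsFace [Fintype ι] (A : Set (σ →₀ ℕ)) (v : ι → σ →₀ ℕ) : Prop :=
  ∀ c : ι → ℕ, Minimal (· ∈ nfoldSum A (∑ i, c i)) (∑ i, c i • v i)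

/-- The vectors `(v i, 1)` are linearly independent, phrased over the natural numbers. -/
def IsIndep [Fintype ι] (v : ι → σ →₀ ℕ) : Prop :=
  ∀ c c' : ι → ℕ, ∑ i, c i = ∑ i, c' i → ∑ i, c i • v i = ∑ i, c' i • v i → c = c'

/-- `d` is the largest size of an independent face. -/
def IsFaceRank (A : Set (σ →₀ ℕ)) (d : ℕ) : Prop :=
  (∃ v : Fin d → σ →₀ ℕ, IsFace A v ∧ IsIndep v) ∧
    ∀ (r : ℕ) (v : Fin r → σ →₀ ℕ), IsFace A v → IsIndep v → r ≤ d

section face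

variable [Fintype ι] [Fintype κ] {A B : Set (σ →₀ ℕ)} {v : ι → σ →₀ ℕ}

/-- Extending coefficients by zero is what passes faces and independence to subfamilies. -/
theorem sum_extend {M : Type*} [AddCommMonoid M] (e : κ ↪ ι) (c : κ → ℕ) (f : ι → M) :
    ∑ i, Function.extend e c 0 i • f i = ∑ i, c i • f (e i) := by
  symm
  refine Fintype.sum_of_injective e e.injective _ _ ?_ ?_
  · intro i hi
    rw [Function.extend_apply' _ _ _ (fun ⟨x, hx⟩ => hi ⟨x, hx⟩)]
    simp
  · intro i
    rw [e.injective.extend_apply]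

theorem sum_extend' (e : κ ↪ ι) (c : κ → ℕ) :
    ∑ i, Function.extend e c 0 i = ∑ i, c i := by
  simpa using sum_extend e c (fun _ => (1 : ℕ))

theorem IsFace.mem (h : IsFace A v) (i : ι) : v i ∈ A := by
  classical
  have := (h (Pi.single i 1)).1
  rw [Finset.sum_pi_single' i 1, if_pos (Finset.mem_univ i)] at this
  obtain ⟨a, ha, s, hs, has⟩ := this
  obtain rfl : s = 0 := hs
  simp only [Pi.single_apply, ite_smul, one_smul, zero_smul, Finset.sum_ite_eq',
    Finset.mem_univ, if_true, add_zero] at has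
  exact has ▸ ha

theorem IsFace.comp (h : IsFace A v) (e : κ ↪ ι) : IsFace A (v ∘ e) := by
  intro c
  have := h (Function.extend e c 0)
  rwa [sum_extend, sum_extend'] at this

theorem IsIndep.comp (h : IsIndep v) (e : κ ↪ ι) : IsIndep (v ∘ e) := by
  intro c c' h1 h2
  have := h (Function.extend e c 0) (Function.extend e c' 0)
    (by rw [sum_extend', sum_extend', h1]) (by rw [sum_extend, sum_extend]; exact h2)
  funext i
  simpa [e.injective.extend_apply] using congr_fun this (e i)

theorem IsFace.of_subset (hAB : A ⊆ B) (h : IsFace B v) (hv : ∀ i, v i ∈ A) : IsFace A v := by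
  intro c
  exact ⟨sum_mem_nfoldSum hv c _, fun s hs hle => (h c).2 (nfoldSum_mono hAB _ hs) hle⟩

theorem IsFaceRank.card_le {d : ℕ} (hd : IsFaceRank A d) (h : IsFace A v) (hi : IsIndep v) :
    Fintype.card ι ≤ d :=
  hd.2 _ _ (h.comp (Fintype.equivFin ι).symm.toEmbedding)
    (hi.comp (Fintype.equivFin ι).symm.toEmbedding)

/-- The rational vector `(v i, 1)`. -/
def homVec (v : ι → σ →₀ ℕ) (i : ι) : (σ → ℚ) × ℚ := (fun j => (v i j : ℚ), 1)

/-- Clearing denominators reduces rational relations to integral ones, and splitting integers into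
positive and negative parts turns these into equalities with natural coefficients. The last
coordinate `1` records the equality of coefficient sums. -/
theorem isIndep_iff_linearIndependent : IsIndep v ↔ LinearIndependent ℚ (homVec v) := by
  constructor
  · intro h
    rw [← LinearIndependent.iff_fractionRing ℤ ℚ, Fintype.linearIndependent_iff]
    intro g hg
    have hg1 : ∀ j, ∑ i, (g i : ℚ) * v i j = 0 := fun j => by
      simpa [homVec, Finset.sum_apply, Prod.fst_sum] using congr_fun (congr_arg Prod.fst hg) j
    have hg2 : ∑ i, (g i : ℚ) = 0 := by
      simpa [homVec, Prod.snd_sum] using congr_arg Prod.snd hg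
    have hsub : ∀ i, ((g i).toNat : ℚ) - ((-g i).toNat : ℚ) = g i := fun i => by
      exact_mod_cast (g i).toNat_sub_toNat_neg
    have := h (fun i => (g i).toNat) (fun i => (-g i).toNat) ?_ ?_
    · intro i
      have h1 := congr_fun this i
      have h2 := (g i).toNat_sub_toNat_neg
      omega
    · rw [← Nat.cast_inj (R := ℚ), ← sub_eq_zero]
      push_cast
      rw [← Finset.sum_sub_distrib, ← hg2]
      exact Finset.sum_congr rfl fun i _ => hsub i
    · ext j
      rw [← Nat.cast_inj (R := ℚ), ← sub_eq_zero]
      simp only [Finsupp.finsetSum_apply, Finsupp.smul_apply, smul_eq_mul]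
      push_cast
      rw [← Finset.sum_sub_distrib, ← hg1 j]
      refine Finset.sum_congr rfl fun i _ => ?_
      rw [← sub_mul, hsub]
  · intro h c c' h1 h2
    rw [Fintype.linearIndependent_iff] at h
    have := h (fun i => (c i : ℚ) - c' i) ?_
    · funext i
      have := this i
      rw [sub_eq_zero] at this
      exact_mod_cast this
    · refine Prod.ext ?_ ?_
      · funext j
        have h3 := congr_arg (Nat.cast (R := ℚ)) (DFunLike.congr_fun h2 j)
        simp only [Finsupp.finsetSum_apply, Finsupp.smul_apply, smul_eq_mul] at h3
        push_cast at h3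
        simp [homVec, Prod.fst_sum, Finset.sum_apply, sub_mul, h3]
      · have h3 := congr_arg (Nat.cast (R := ℚ)) h1
        push_cast at h3
        simp [homVec, Prod.snd_sum, h3]

/-- A basis of the span can be chosen inside the family, and a subfamily of a face is a face. -/
theorem IsFaceRank.finrank_span_le {d : ℕ} (hd : IsFaceRank A d) (h : IsFace A v) :
    Module.finrank ℚ (Submodule.span ℚ (Set.range (homVec v))) ≤ d := by
  obtain ⟨κ, e, he, hspan, hli⟩ := exists_linearIndependent' ℚ (homVec v)
  have : Fintype κ := Fintype.ofInjective e he
  rw [← hspan, finrank_span_eq_card hli]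
  exact hd.card_le (h.comp ⟨e, he⟩) (isIndep_iff_linearIndependent.mpr hli)

end face

end AnalyticSpread

namespace AnalyticSpread

/-! ### Ranks of faces for unions and sumsets -/

variable {σ : Type*} {A B : Set (σ →₀ ℕ)}

/-- A nonempty set of exponents has a face with one element. -/
theorem IsFaceRank.pos {d : ℕ} (hd : IsFaceRank A d) (hA : A.Nonempty) : 1 ≤ d := by
  -- With `a` of least total degree, a sum of `k` exponents has degree at least that of `k • a`, so
  -- it cannot lie strictly below `k • a`.
  obtain ⟨a, ha, hmin⟩ := exists_minimalFor_of_wellFoundedLT (· ∈ A) Finsupp.degree hA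
  have hdeg : ∀ b ∈ A, a.degree ≤ b.degree := fun b hb => by
    by_contra h
    exact h (hmin hb (not_le.mp h).le)
  refine hd.2 1 (fun _ => a) (fun c => ?_) (fun c c' h _ => ?_)
  · refine ⟨sum_mem_nfoldSum (fun _ => ha) c _, fun s hs hle => ?_⟩
    have h1 := degree_le_of_mem_nfoldSum hdeg hs
    obtain ⟨t, ht⟩ := exists_add_of_le hle
    have h2 := congr_arg Finsupp.degree ht
    simp only [map_add, Finset.univ_unique, Finset.sum_singleton, map_nsmul, smul_eq_mul] at h1 h2
    have h3 : t.degree = 0 := by omega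
    rw [Finsupp.degree_eq_zero_iff] at h3
    rw [ht, h3, add_zero]
  · funext i
    fin_cases i
    simpa using h

theorem IsFaceRank.le_add_of_union {d e f : ℕ} (hd : IsFaceRank A d) (he : IsFaceRank B e)
    (hf : IsFaceRank (A ∪ B) f) : f ≤ d + e := by
  classical
  obtain ⟨v, hv, hi⟩ := hf.1
  have h1 := hd.card_le (ι := {i // v i ∈ A})
    ((hv.comp (Function.Embedding.subtype _)).of_subset Set.subset_union_left fun i => i.2)
    (hi.comp (Function.Embedding.subtype _))
  have h2 := he.card_le (ι := {i // ¬ v i ∈ A})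
    ((hv.comp (Function.Embedding.subtype _)).of_subset Set.subset_union_right
      fun i => (hv.mem i.1).resolve_left i.2)
    (hi.comp (Function.Embedding.subtype _))
  have h3 := Fintype.card_subtype_compl (fun i => v i ∈ A)
  have h4 := Fintype.card_subtype_le (fun i => v i ∈ A)
  rw [Fintype.card_fin] at h3 h4
  omega

theorem IsFaceRank.add_le_of_union {U V : Set σ} (hUV : Disjoint U V)
    (hA : ∀ a ∈ A, ∀ i ∈ a.support, i ∈ U) (hB : ∀ a ∈ B, ∀ i ∈ a.support, i ∈ V)
    (hA0 : (0 : σ →₀ ℕ) ∉ A) (hB0 : (0 : σ →₀ ℕ) ∉ B) {d e f : ℕ}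
    (hd : IsFaceRank A d) (he : IsFaceRank B e) (hf : IsFaceRank (A ∪ B) f) : d + e ≤ f := by
  obtain ⟨v, hv, hvi⟩ := hd.1
  obtain ⟨w, hw, hwi⟩ := he.1
  have := hf.card_le (ι := Fin d ⊕ Fin e) (v := Sum.elim v w) ?_ ?_
  · simpa using this
  · intro c
    simpa [Fintype.sum_sum_type] using minimal_add_nfoldSum_union hUV hA hB hA0 hB0
      (hv fun i => c (Sum.inl i)) (hw fun i => c (Sum.inr i))
  · intro c c' h1 h2
    simp only [Fintype.sum_sum_type, Sum.elim_inl, Sum.elim_inr] at h1 h2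
    obtain ⟨h3, h4⟩ := eq_and_eq_of_add_eq_add hUV hA hB (hv fun i => c (Sum.inl i)).1
      (hw fun i => c (Sum.inr i)).1 (hv fun i => c' (Sum.inl i)).1
      (hw fun i => c' (Sum.inr i)).1 h2
    -- Only the total coefficient sums are known to agree; minimality determines the number of
    -- factors on the `A` side, hence also on the `B` side.
    have h5 := degree_unique_of_minimal_nfoldSum hA0 (hv fun i => c (Sum.inl i))
      (by rw [h3]; exact hv fun i => c' (Sum.inl i))
    have h6 := hvi _ _ h5 h3
    have h7 := hwi _ _ (by omega) h4
    funext i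
    rcases i with i | i
    · exact congr_fun h6 i
    · exact congr_fun h7 i

theorem IsFaceRank.add_le_of_image2 {U V : Set σ} (hUV : Disjoint U V)
    (hA : ∀ a ∈ A, ∀ i ∈ a.support, i ∈ U) (hB : ∀ a ∈ B, ∀ i ∈ a.support, i ∈ V)
    (hAne : A.Nonempty) (hBne : B.Nonempty) {d e f : ℕ} (hd : IsFaceRank A d)
    (he : IsFaceRank B e) (hf : IsFaceRank (Set.image2 (· + ·) A B) f) : d + e ≤ f + 1 := by
  obtain ⟨d, rfl⟩ := Nat.exists_eq_add_of_le' (hd.pos hAne)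
  obtain ⟨e, rfl⟩ := Nat.exists_eq_add_of_le' (he.pos hBne)
  obtain ⟨v, hv, hvi⟩ := hd.1
  obtain ⟨w, hw, hwi⟩ := he.1
  -- The pairs in `x` below are the edges of a double star: `v 0` with every `w j`, and `w 0` with
  -- every other `v i`. This spanning tree has `(d + 1) + (e + 1) - 1` edges; `cv` and `cw` are the
  -- coefficients induced on its vertices.
  let cv : (Fin d ⊕ Fin (e + 1) → ℕ) → Fin (d + 1) → ℕ := fun c =>
    Fin.cons (∑ j, c (Sum.inr j)) fun i => c (Sum.inl i)
  let cw : (Fin d ⊕ Fin (e + 1) → ℕ) → Fin (e + 1) → ℕ := fun c =>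
    Fin.cons (c (Sum.inr 0) + ∑ i, c (Sum.inl i)) fun j => c (Sum.inr j.succ)
  have hcv : ∀ c, ∑ i, cv c i = ∑ i, c i := fun c => by
    simp only [cv, Fin.sum_univ_succ (n := d), Fin.cons_zero, Fin.cons_succ, Fintype.sum_sum_type]
    ring
  have hcw : ∀ c, ∑ i, cw c i = ∑ i, c i := fun c => by
    simp only [cw, Fin.sum_univ_succ (n := e), Fin.cons_zero, Fin.cons_succ, Fintype.sum_sum_type]
    ring
  let x : Fin d ⊕ Fin (e + 1) → σ →₀ ℕ :=
    Sum.elim (fun i => v i.succ + w 0) (fun j => v 0 + w j)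
  have hx : ∀ c : Fin d ⊕ Fin (e + 1) → ℕ,
      ∑ i, c i • x i = ∑ i, cv c i • v i + ∑ i, cw c i • w i := fun c => by
    simp only [x, cv, cw, Fintype.sum_sum_type, Sum.elim_inl, Sum.elim_inr, Fin.sum_univ_succ,
      Fin.cons_zero, Fin.cons_succ, smul_add, Finset.sum_add_distrib, add_smul, Finset.sum_smul]
    abel
  have := hf.card_le (v := x) ?_ ?_
  · simp only [Fintype.card_sum, Fintype.card_fin] at this
    omega
  · intro c
    rw [hx]
    refine minimal_add_nfoldSum_image2 hUV hA hB ?_ ?_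
    · rw [← hcv]; exact hv _
    · rw [← hcw]; exact hw _
  · intro c c' h1 h2
    rw [hx, hx] at h2
    obtain ⟨h3, h4⟩ := eq_and_eq_of_add_eq_add hUV hA hB (hv _).1 (hw _).1 (hv _).1 (hw _).1 h2
    have h5 := hvi _ _ (by rw [hcv, hcv, h1]) h3
    have h6 := hwi _ _ (by rw [hcw, hcw, h1]) h4
    have h7 : ∀ i, c (Sum.inl i) = c' (Sum.inl i) := fun i => by
      simpa [cv] using congr_fun h5 i.succ
    have h8 : ∀ j : Fin e, c (Sum.inr j.succ) = c' (Sum.inr j.succ) := fun j => by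
      simpa [cw] using congr_fun h6 j.succ
    -- The leaves determine their edges; the central edge is then what remains of the coefficient of
    -- `w 0`.
    have h9 : c (Sum.inr 0) = c' (Sum.inr 0) := by
      simpa [cw, h7] using congr_fun h6 0
    funext i
    rcases i with i | i
    · exact h7 i
    · exact Fin.cases h9 h8 i

theorem IsFaceRank.lt_add_of_image2 [Finite σ] {d e f : ℕ} (hd : IsFaceRank A d)
    (he : IsFaceRank B e) (hAne : A.Nonempty) (hf : IsFaceRank (Set.image2 (· + ·) A B) f) :
    f + 1 ≤ d + e := by
  have hd1 := hd.pos hAne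
  rcases Nat.eq_zero_or_pos f with rfl | hfpos
  · omega
  obtain ⟨x, hx, hxi⟩ := hf.1
  choose a ha b hb hab using fun i => hx.mem i
  have hsum : ∀ c : Fin f → ℕ, ∑ i, c i • x i = ∑ i, c i • a i + ∑ i, c i • b i := fun c => by
    simp [← hab, Finset.sum_add_distrib]
  -- Replacing the `A`-part by a smaller `s` while keeping the `B`-part would give a competitor to
  -- the minimal sum; cancellation transfers minimality.
  have haf : IsFace A a := fun c => by
    refine ⟨sum_mem_nfoldSum ha c _, fun s hs hle => ?_⟩
    have h := (hx c).2 (mem_nfoldSum_image2.mpr ⟨s, hs, _, sum_mem_nfoldSum hb c _, rfl⟩)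
      (by rw [hsum]; exact add_le_add_left hle _)
    rw [hsum] at h
    exact le_of_add_le_add_right h
  have hbf : IsFace B b := fun c => by
    refine ⟨sum_mem_nfoldSum hb c _, fun s hs hle => ?_⟩
    have h := (hx c).2 (mem_nfoldSum_image2.mpr ⟨_, sum_mem_nfoldSum ha c _, s, hs, rfl⟩)
      (by rw [hsum]; exact add_le_add_right hle _)
    rw [hsum] at h
    exact le_of_add_le_add_left h
  have h1 := hd.finrank_span_le haf
  have h2 := he.finrank_span_le hbf
  set M := Submodule.span ℚ (Set.range (homVec a))
  set N := Submodule.span ℚ (Set.range (homVec b))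
  have ham : ∀ i, homVec a i ∈ M := fun i => Submodule.subset_span ⟨i, rfl⟩
  have hbm : ∀ i, homVec b i ∈ N := fun i => Submodule.subset_span ⟨i, rfl⟩
  have : Fintype σ := Fintype.ofFinite σ
  let y : Fin f → M × N := fun i => (⟨homVec a i, ham i⟩, ⟨homVec b i, hbm i⟩)
  -- Adding exponents and keeping one copy of the degree sends `y i` to `homVec x i`, so
  -- independence pulls back to `y`.
  let ψ : M × N →ₗ[ℚ] (σ → ℚ) × ℚ :=
    LinearMap.prod
      (LinearMap.fst ℚ (σ → ℚ) ℚ ∘ₗ M.subtype ∘ₗ LinearMap.fst ℚ M N +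
        LinearMap.fst ℚ (σ → ℚ) ℚ ∘ₗ N.subtype ∘ₗ LinearMap.snd ℚ M N)
      (LinearMap.snd ℚ (σ → ℚ) ℚ ∘ₗ M.subtype ∘ₗ LinearMap.fst ℚ M N)
  have hy : LinearIndependent ℚ y := by
    refine LinearIndependent.of_comp ψ ?_
    convert isIndep_iff_linearIndependent.mp hxi using 1
    funext i
    refine Prod.ext ?_ rfl
    funext j
    simp [ψ, y, homVec, ← hab]
  -- The difference of the two degrees vanishes on every `y i` but not on `(homVec a 0, 0)`; hence
  -- the `f` independent vectors `y i` span a proper subspace of `M × N`.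
  let φ : M × N →ₗ[ℚ] ℚ :=
    LinearMap.snd ℚ (σ → ℚ) ℚ ∘ₗ M.subtype ∘ₗ LinearMap.fst ℚ M N -
      LinearMap.snd ℚ (σ → ℚ) ℚ ∘ₗ N.subtype ∘ₗ LinearMap.snd ℚ M N
  have hle : Submodule.span ℚ (Set.range y) ≤ LinearMap.ker φ := by
    rw [Submodule.span_le]
    rintro _ ⟨i, rfl⟩
    simp [φ, y, homVec]
  have hlt : Submodule.span ℚ (Set.range y) < ⊤ := by
    refine hle.trans_lt (lt_top_iff_ne_top.mpr fun h => ?_)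
    have : ((⟨homVec a ⟨0, hfpos⟩, ham _⟩, 0) : M × N) ∈ LinearMap.ker φ := h ▸ trivial
    simp [φ, homVec] at this
  have h3 := Submodule.finrank_lt (lt_top_iff_ne_top.mp hlt)
  rw [finrank_span_eq_card hy, Fintype.card_fin, Module.finrank_prod] at h3
  omega

end AnalyticSpread

namespace AnalyticSpread

/-! ### Fiber rings of monomial ideals -/

variable {K : Type*} [Field K] {n : ℕ} {A B : Set (Fin n →₀ ℕ)}

/-- The monomial ideal with generating exponents `A`. -/
noncomputable abbrev monomialIdeal (K : Type*) [Field K] {n : ℕ} (A : Set (Fin n →₀ ℕ)) :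
    Ideal (MvPolynomial (Fin n) K) :=
  Ideal.span ((fun a => MvPolynomial.monomial a (1 : K)) '' A)

theorem monomialIdeal_mul :
    monomialIdeal K A * monomialIdeal K B = monomialIdeal K (Set.image2 (· + ·) A B) := by
  rw [monomialIdeal, monomialIdeal, Ideal.span_mul_span']
  congr 1
  ext f
  constructor
  · rintro ⟨_, ⟨a, ha, rfl⟩, _, ⟨b, hb, rfl⟩, rfl⟩
    exact ⟨a + b, ⟨a, ha, b, hb, rfl⟩, by simp [MvPolynomial.monomial_mul]⟩
  · rintro ⟨_, ⟨a, ha, b, hb, rfl⟩, rfl⟩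
    exact ⟨_, ⟨a, ha, rfl⟩, _, ⟨b, hb, rfl⟩, by simp [MvPolynomial.monomial_mul]⟩

theorem monomialIdeal_pow (k : ℕ) : monomialIdeal K A ^ k = monomialIdeal K (nfoldSum A k) := by
  induction k with
  | zero =>
    simp only [pow_zero, nfoldSum, monomialIdeal, Set.image_singleton]
    rw [Ideal.one_eq_top]
    exact (Ideal.span_singleton_one (α := MvPolynomial (Fin n) K)).symm
  | succ k ih => rw [pow_succ', ih, monomialIdeal_mul, nfoldSum]

theorem monomialIdeal_union :
    monomialIdeal K A + monomialIdeal K B = monomialIdeal K (A ∪ B) := by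
  rw [monomialIdeal, monomialIdeal, monomialIdeal, Set.image_union, Ideal.span_union]
  rfl

theorem idealOfVars_eq_monomialIdeal :
    MvPolynomial.idealOfVars (Fin n) K =
      monomialIdeal K (Set.range fun i => Finsupp.single i 1) := by
  rw [MvPolynomial.idealOfVars, monomialIdeal, ← Set.range_comp]
  rfl

theorem exists_lt_of_mem_idealOfVars_mul {k : ℕ} {f : MvPolynomial (Fin n) K}
    (hf : f ∈ MvPolynomial.idealOfVars (Fin n) K * monomialIdeal K A ^ k) {x : Fin n →₀ ℕ}
    (hx : x ∈ f.support) : ∃ a ∈ nfoldSum A k, a < x := by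
  rw [idealOfVars_eq_monomialIdeal, monomialIdeal_pow, monomialIdeal_mul,
    MvPolynomial.mem_ideal_span_monomial_image] at hf
  obtain ⟨_, ⟨_, ⟨i, rfl⟩, a, ha, rfl⟩, hle⟩ := hf x hx
  refine ⟨a, ha, lt_of_lt_of_le (lt_add_of_pos_left a ?_) hle⟩
  exact pos_iff_ne_zero.mpr (by simp)

/-- Multiplying by a Rees element is harmless degree by degree, because `I ^ i * (𝔪 * I ^ j) = 𝔪 * I
^ (i + j)`. This gives a coefficientwise test for being nonzero in the fiber ring. -/
theorem coeff_mem_of_mem_map {I : Ideal (MvPolynomial (Fin n) K)} {g : reesAlgebra I}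
    (hg : g ∈ (MvPolynomial.idealOfVars (Fin n) K).map
      (algebraMap (MvPolynomial (Fin n) K) (reesAlgebra I))) (k : ℕ) :
    (g : Polynomial (MvPolynomial (Fin n) K)).coeff k ∈
      MvPolynomial.idealOfVars (Fin n) K * I ^ k := by
  induction hg using Submodule.span_induction generalizing k with
  | mem g hg =>
    obtain ⟨s, hs, rfl⟩ := hg
    change (Polynomial.C s).coeff k ∈ _
    rw [Polynomial.coeff_C]
    split_ifs with hk
    · subst hk
      simpa using hs
    · exact zero_mem _
  | zero => simp
  | add g h _ _ ihg ihh =>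
    rw [Subalgebra.coe_add, Polynomial.coeff_add]
    exact add_mem (ihg k) (ihh k)
  | smul r g _ ih =>
    rw [smul_eq_mul, Subalgebra.coe_mul, Polynomial.coeff_mul]
    refine Ideal.sum_mem _ fun p hp => ?_
    rw [← Finset.HasAntidiagonal.mem_antidiagonal.mp hp, pow_add, mul_left_comm]
    exact Ideal.mul_mem_mul (r.2 p.1) (ih p.2)

theorem monomial_mem_pow {k : ℕ} {a : Fin n →₀ ℕ} (ha : a ∈ nfoldSum A k) :
    MvPolynomial.monomial a (1 : K) ∈ monomialIdeal K A ^ k := by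
  rw [monomialIdeal_pow]
  exact Ideal.subset_span ⟨a, ha, rfl⟩

/-- The element `x ^ a * t ^ k` of the Rees algebra. -/
noncomputable def reesMonomial (K : Type*) [Field K] {n : ℕ} {A : Set (Fin n →₀ ℕ)} {k : ℕ}
    {a : Fin n →₀ ℕ} (ha : a ∈ nfoldSum A k) : reesAlgebra (monomialIdeal K A) :=
  ⟨Polynomial.monomial k (MvPolynomial.monomial a 1),
    reesAlgebra.monomial_mem.mpr (monomial_mem_pow ha)⟩

theorem prod_reesMonomial_pow {ι : Type*} [Fintype ι] {v : ι → Fin n →₀ ℕ} (hv : ∀ i, v i ∈ A)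
    (c : ι → ℕ) :
    ∏ i, reesMonomial K (mem_nfoldSum_one (hv i)) ^ c i =
      reesMonomial K (sum_mem_nfoldSum hv c Finset.univ) := by
  classical
  apply Subtype.ext
  simp only [reesMonomial, SubmonoidClass.coe_finsetProd, SubmonoidClass.coe_pow,
    Polynomial.monomial_pow, MvPolynomial.monomial_pow, one_pow, one_mul]
  generalize (Finset.univ : Finset ι) = s
  induction s using Finset.induction_on with
  | empty => simp
  | insert i s hi ih =>
    rw [Finset.prod_insert hi, Finset.sum_insert hi, Finset.sum_insert hi, ih,
      Polynomial.monomial_mul_monomial, MvPolynomial.monomial_mul, one_mul]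

theorem reesMonomial_mem_map_of_lt {k : ℕ} {a b : Fin n →₀ ℕ} (ha : a ∈ nfoldSum A k)
    (hb : b ∈ nfoldSum A k) (hab : a < b) :
    reesMonomial K hb ∈ (MvPolynomial.idealOfVars (Fin n) K).map
      (algebraMap (MvPolynomial (Fin n) K) (reesAlgebra (monomialIdeal K A))) := by
  obtain ⟨u, rfl⟩ := exists_add_of_le hab.le
  have hu : MvPolynomial.monomial u (1 : K) ∈ MvPolynomial.idealOfVars (Fin n) K := by
    rw [idealOfVars_eq_monomialIdeal, MvPolynomial.mem_ideal_span_monomial_image]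
    intro x hx
    obtain rfl : x = u := by simpa using MvPolynomial.support_monomial_subset hx
    have hx0 : x ≠ 0 := by
      rintro rfl
      simp at hab
    obtain ⟨i, hi⟩ := Finsupp.ne_iff.mp hx0
    refine ⟨_, ⟨i, rfl⟩, ?_⟩
    rw [Finsupp.single_le_iff]
    exact Nat.one_le_iff_ne_zero.mpr hi
  have hmul : reesMonomial K hb =
      algebraMap (MvPolynomial (Fin n) K) (reesAlgebra (monomialIdeal K A))
        (MvPolynomial.monomial u 1) * reesMonomial K ha := by
    apply Subtype.ext
    change Polynomial.monomial k _ = Polynomial.C _ * Polynomial.monomial k _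
    rw [Polynomial.C_mul_monomial, MvPolynomial.monomial_mul, one_mul, add_comm]
  rw [hmul]
  exact Ideal.mul_mem_right _ _ (Ideal.mem_map_of_mem _ hu)

/-- The fiber ring of a monomial ideal is generated by the monomials of degree one. -/
theorem adjoin_fiberRing_eq_top :
    Algebra.adjoin K (Set.range fun a : A =>
      (Ideal.Quotient.mk _ (reesMonomial K (mem_nfoldSum_one a.2)) :
        FiberRing (monomialIdeal K A))) = ⊤ := by
  set T := Algebra.adjoin K (Set.range fun a : A =>
      (Ideal.Quotient.mk _ (reesMonomial K (mem_nfoldSum_one a.2)) :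
        FiberRing (monomialIdeal K A)))
  have hrees : reesAlgebra (monomialIdeal K A) = Algebra.adjoin (MvPolynomial (Fin n) K)
      (Set.range fun a : A => (Polynomial.monomial 1 (MvPolynomial.monomial (a : Fin n →₀ ℕ) 1) :
        Polynomial (MvPolynomial (Fin n) K))) := by
    rw [← adjoin_monomial_eq_reesAlgebra, monomialIdeal, Ideal.span, Submodule.map_span,
      Algebra.adjoin_span, Set.image_image]
    congr 1
    ext
    simp
  have key : ∀ (g : Polynomial (MvPolynomial (Fin n) K))
      (_ : g ∈ Algebra.adjoin (MvPolynomial (Fin n) K)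
        (Set.range fun a : A => (Polynomial.monomial 1 (MvPolynomial.monomial
          (a : Fin n →₀ ℕ) 1) : Polynomial (MvPolynomial (Fin n) K))))
      (hg : g ∈ reesAlgebra (monomialIdeal K A)),
      (Ideal.Quotient.mk _ ⟨g, hg⟩ : FiberRing (monomialIdeal K A)) ∈ T := by
    intro g hg'
    induction hg' using Algebra.adjoin_induction with
    | mem g hg' =>
      obtain ⟨a, rfl⟩ := hg'
      intro hg
      exact Algebra.subset_adjoin ⟨a, rfl⟩
    | algebraMap s =>
      intro hg
      -- Modulo `𝔪` a polynomial equals its constant term, so coefficients in `K` suffice.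
      have hs : s - MvPolynomial.C (MvPolynomial.constantCoeff s) ∈
          MvPolynomial.idealOfVars (Fin n) K := by
        rw [idealOfVars_eq_monomialIdeal, MvPolynomial.mem_ideal_span_monomial_image]
        intro x hx
        have hx0 : x ≠ 0 := by
          rintro rfl
          simp [MvPolynomial.constantCoeff_eq] at hx
        obtain ⟨i, hi⟩ := Finsupp.ne_iff.mp hx0
        refine ⟨_, ⟨i, rfl⟩, ?_⟩
        rw [Finsupp.single_le_iff]
        exact Nat.one_le_iff_ne_zero.mpr hi
      have heq : (Ideal.Quotient.mk _ ⟨_, hg⟩ : FiberRing (monomialIdeal K A)) =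
          algebraMap K _ (MvPolynomial.constantCoeff s) := by
        refine Ideal.Quotient.eq.mpr ?_
        convert Ideal.mem_map_of_mem
          (algebraMap (MvPolynomial (Fin n) K) (reesAlgebra (monomialIdeal K A))) hs using 1
        rw [map_sub]
        rfl
      rw [heq]
      exact T.algebraMap_mem _
    | add g h hg' hh' ihg ihh =>
      intro hgh
      rw [← hrees] at hg' hh'
      exact T.add_mem (ihg hg') (ihh hh')
    | mul g h hg' hh' ihg ihh =>
      intro hgh
      rw [← hrees] at hg' hh'
      exact T.mul_mem (ihg hg') (ihh hh')
  rw [eq_top_iff]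
  rintro f -
  obtain ⟨⟨g, hg⟩, rfl⟩ := Ideal.Quotient.mk_surjective f
  exact key g (hrees ▸ hg) hg

/-- An independent face gives algebraically independent elements of the fiber ring. -/
theorem algebraicIndependent_of_isFace {ι : Type*} [Fintype ι] {v : ι → Fin n →₀ ℕ}
    (hv : IsFace A v) (hi : IsIndep v) :
    AlgebraicIndependent K (fun i =>
      (Ideal.Quotient.mk _ (reesMonomial K (mem_nfoldSum_one (hv.mem i))) :
        FiberRing (monomialIdeal K A))) := by
  classical
  rw [algebraicIndependent_iff]
  intro p hp
  let y : ι → reesAlgebra (monomialIdeal K A) :=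
    fun i => reesMonomial K (mem_nfoldSum_one (hv.mem i))
  have hcomp : MvPolynomial.aeval (R := K) (fun i =>
      (Ideal.Quotient.mk _ (y i) : FiberRing (monomialIdeal K A))) =
      (Ideal.Quotient.mkₐ K _).comp (MvPolynomial.aeval y) := by
    ext i
    simp
  change MvPolynomial.aeval (fun i =>
      (Ideal.Quotient.mk _ (y i) : FiberRing (monomialIdeal K A))) p = 0 at hp
  rw [hcomp] at hp
  have hmem := Ideal.Quotient.eq_zero_iff_mem.mp hp
  by_contra hp0
  obtain ⟨c₀, hc₀⟩ := MvPolynomial.support_nonempty.mpr hp0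
  have hcoeff := coeff_mem_of_mem_map hmem (∑ i, c₀ i)
  have hval : ((MvPolynomial.aeval y p : reesAlgebra (monomialIdeal K A)) :
      Polynomial (MvPolynomial (Fin n) K)) = ∑ c ∈ p.support,
        Polynomial.monomial (∑ i, c i) (MvPolynomial.monomial (∑ i, c i • v i) (p.coeff c)) := by
    rw [MvPolynomial.aeval_def, MvPolynomial.eval₂_eq', AddSubmonoidClass.coe_finsetSum]
    refine Finset.sum_congr rfl fun c _ => ?_
    rw [prod_reesMonomial_pow hv.mem c]
    change Polynomial.C (MvPolynomial.C (p.coeff c)) * Polynomial.monomial _ _ = _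
    rw [Polynomial.C_mul_monomial, MvPolynomial.C_mul_monomial, mul_one]
  -- By independence no other monomial of `p` contributes to this bidegree, so the coefficient is
  -- `p.coeff c₀`, with no cancellation.
  have hsupp : ∑ i, c₀ i • v i ∈ (((MvPolynomial.aeval y p : reesAlgebra (monomialIdeal K A)) :
      Polynomial (MvPolynomial (Fin n) K)).coeff (∑ i, c₀ i)).support := by
    rw [MvPolynomial.mem_support_iff, hval, Polynomial.finsetSum_coeff,
      MvPolynomial.coeff_sum, Finset.sum_eq_single c₀]
    · simpa using hc₀
    · intro c _ hc
      rw [Polynomial.coeff_monomial]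
      split_ifs with h
      · rw [MvPolynomial.coeff_monomial, if_neg]
        intro h'
        exact hc (DFunLike.coe_injective (hi c c₀ h h'))
      · simp
    · intro h
      exact absurd hc₀ h
  obtain ⟨a, ha, hlt⟩ := exists_lt_of_mem_idealOfVars_mul hcoeff hsupp
  exact hlt.not_ge ((hv c₀).2 ha hlt.le)

/-- The analytic spread of a monomial ideal is the largest size of an independent face. -/
theorem exists_analyticSpread_eq_and_isFaceRank (K : Type*) [Field K] {n : ℕ}
    (A : Set (Fin n →₀ ℕ)) :
    ∃ d : ℕ, analyticSpread (monomialIdeal K A) = d ∧ IsFaceRank A d := by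
  have hnt : Nontrivial (FiberRing (monomialIdeal K A)) := by
    obtain ⟨d, hd⟩ := exists_nat_eq_analyticSpread (monomialIdeal K A)
    by_contra h
    rw [not_nontrivial_iff_subsingleton] at h
    rw [analyticSpread, ringKrullDim_eq_bot_of_subsingleton] at hd
    exact absurd hd (by simp)
  have : Algebra.FiniteType K (reesAlgebra (monomialIdeal K A)) :=
    Algebra.FiniteType.trans (S := MvPolynomial (Fin n) K) inferInstance inferInstance
  have : Algebra.FiniteType K (FiberRing (monomialIdeal K A)) :=
    Algebra.FiniteType.of_surjective (Ideal.Quotient.mkₐ K _) (Ideal.Quotient.mkₐ_surjective K _)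
  obtain ⟨d, hd, hle, P, hP, x, hxX, hx⟩ :=
    exists_nat_ringKrullDim_eq (K := K) (A := FiberRing (monomialIdeal K A)) (Set.range fun a : A =>
      (Ideal.Quotient.mk _ (reesMonomial K (mem_nfoldSum_one a.2)) :
        FiberRing (monomialIdeal K A))) adjoin_fiberRing_eq_top
  refine ⟨d, hd, ?_, fun r v hv hi => hle r _ (algebraicIndependent_of_isFace hv hi)⟩
  choose a ha using hxX
  obtain rfl : (fun i => Ideal.Quotient.mk _ (reesMonomial K (mem_nfoldSum_one (a i).2))) = x :=
    funext ha
  have hav : ∀ i, (a i : Fin n →₀ ℕ) ∈ A := fun i => (a i).2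
  have haeval : ∀ c : Fin d → ℕ, MvPolynomial.aeval (R := K) (fun i => Ideal.Quotient.mk P
      (Ideal.Quotient.mk _ (reesMonomial K (mem_nfoldSum_one (a i).2))))
      (MvPolynomial.monomial (Finsupp.equivFunOnFinite.symm c) 1) = Ideal.Quotient.mk P
      (Ideal.Quotient.mk _ (reesMonomial K (sum_mem_nfoldSum hav c Finset.univ))) := fun c => by
    rw [← prod_reesMonomial_pow hav c, MvPolynomial.aeval_monomial]
    simp [Finsupp.prod_fintype]
  refine ⟨fun i => a i, fun c => ⟨sum_mem_nfoldSum hav c _, fun s hs hle => ?_⟩,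
    fun c c' h1 h2 => ?_⟩
  -- A non-minimal product is zero in the fiber ring, hence modulo `P`, giving a monomial relation
  -- among independent elements.
  · by_contra h
    have hmem := reesMonomial_mem_map_of_lt (K := K) hs (sum_mem_nfoldSum hav c _)
      (lt_of_le_not_ge hle h)
    have h0 := haeval c
    rw [Ideal.Quotient.eq_zero_iff_mem.mpr hmem, map_zero] at h0
    have := (algebraicIndependent_iff.mp hx) _ h0
    simp at this
  -- Equal exponents and equal degrees give equal products, and algebraic independence separates
  -- distinct monomials.
  · have heq : reesMonomial K (sum_mem_nfoldSum hav c Finset.univ) =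
        reesMonomial K (sum_mem_nfoldSum hav c' Finset.univ) :=
      Subtype.ext (by simp only [reesMonomial, h1, h2])
    have h3 := ((haeval c).trans (by rw [heq])).trans (haeval c').symm
    have h4 := MvPolynomial.monomial_left_injective (one_ne_zero (α := K)) (hx h3)
    exact Finsupp.equivFunOnFinite.symm.injective h4

end AnalyticSpread

theorem proposition1p3 {K : Type*} [Field K] {n : ℕ}
    (U V : Set (Fin n)) (hUV : Disjoint U V)
    (I J : Ideal (MvPolynomial (Fin n) K))
    (hI : AnalyticSpread.IsMonomialIn U I) (hJ : AnalyticSpread.IsMonomialIn V J) :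
    (I ≠ ⊤ → J ≠ ⊤ →
      AnalyticSpread.analyticSpread (I + J) =
        AnalyticSpread.analyticSpread I + AnalyticSpread.analyticSpread J) ∧
    (I ≠ ⊥ → J ≠ ⊥ →
      AnalyticSpread.analyticSpread (I * J) + 1 =
        AnalyticSpread.analyticSpread I + AnalyticSpread.analyticSpread J) := by
  obtain ⟨A, hA, rfl⟩ := hI
  obtain ⟨B, hB, rfl⟩ := hJ
  obtain ⟨d, hd, hdA⟩ := AnalyticSpread.exists_analyticSpread_eq_and_isFaceRank K A
  obtain ⟨e, he, heB⟩ := AnalyticSpread.exists_analyticSpread_eq_and_isFaceRank K B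
  constructor
  · intro hItop hJtop
    have h0 : ∀ C : Set (Fin n →₀ ℕ), AnalyticSpread.monomialIdeal K C ≠ ⊤ → 0 ∉ C := fun C hC h =>
      hC ((Ideal.eq_top_iff_one _).mpr (Ideal.subset_span ⟨0, h, rfl⟩))
    obtain ⟨f, hf, hfAB⟩ := AnalyticSpread.exists_analyticSpread_eq_and_isFaceRank K (A ∪ B)
    rw [AnalyticSpread.monomialIdeal_union, hd, he, hf]
    have h1 := hdA.le_add_of_union heB hfAB
    have h2 := hdA.add_le_of_union hUV hA hB (h0 A hItop) (h0 B hJtop) heB hfAB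
    exact_mod_cast le_antisymm h1 h2
  · intro hIbot hJbot
    have hne : ∀ C : Set (Fin n →₀ ℕ), AnalyticSpread.monomialIdeal K C ≠ ⊥ → C.Nonempty :=
      fun C hC => Set.nonempty_iff_ne_empty.mpr fun h =>
        hC (by simp [AnalyticSpread.monomialIdeal, h])
    obtain ⟨f, hf, hfAB⟩ :=
      AnalyticSpread.exists_analyticSpread_eq_and_isFaceRank K (Set.image2 (· + ·) A B)
    rw [AnalyticSpread.monomialIdeal_mul, hd, he, hf]
    have h1 := hdA.lt_add_of_image2 heB (hne A hIbot) hfAB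
    have h2 := hdA.add_le_of_image2 hUV hA hB (hne A hIbot) (hne B hJbot) heB hfAB
    exact_mod_cast le_antisymm h1 h2
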